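/- Let $F:\mathbb R^3\to\mathbb R$, $(x,t,e)\mapsto F(x,t,e)$, be smooth with $F(-x,t,e)=-F(x,t,e)$, $F(x,-t,e)=F(x,t,e)$, $F(x,t+2\pi,e)=F(x,t,e)$, $F(x,t,0)=f(x)$ for all $x,t,e$, and $xf(x)>0$ for $x\neq0$. Put $U(x)=\int_0^x f(u)\,du$, and for $0<h<\sup U$ let $T(h)>0$ be the minimal period of the periodic orbit $\tfrac12\dot x^2+U(x)=h$ of $\ddot x+f(x)=0$. Let $m,p\ge1$ be integers and let $0<h_{m,p}<\sup U$ satisfy $T(h_{m,p})=2m\pi/p$ and $T'(h_{m,p})\ne0$. Let $\eta_{m,p}=\sqrt{2h_{m,p}}$. Let $e_0>0$, let $V:[0,e_0)\to\mathbb R$ be continuous with $V(0)=\eta_{m,p}$, and suppose that for each $e\in[0,e_0)$ the function $\phi_{m,p}(\cdot,e):\mathbb R\to\mathbb R$ is a solution of $\ddot x+F(x,t,e)=0$ with $$\phi_{m,p}(0,e)=0,\qquad \dot\phi_{m,p}(0,e)=V(e),\qquad \phi_{m,p}(m\pi,e)=0 .$$ (This is the family of odd, $m\pi$-antiperiodic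 solutions that bifurcates from the odd periodic solution $\phi_{m,p}(t):=\phi_{m,p}(t,0)$ of $\ddot x+f(x)=0$.) For $e\in[0,e_0)$ let $\psi_1(\cdot,e),\psi_2(\cdot,e)$ be the solutions of $\ddot y+\frac{\partial F}{\partial x}(\phi_{m,p}(t,e),t,e)\,y=0$ with $(\psi_1,\dot\psi_1)(0,e)=(1,0)$ and $(\psi_2,\dot\psi_2)(0,e)=(0,1)$, and let $$\tau_{m,p}(e)=\psi_1(2m\pi,e)+\dot\psi_2(2m\pi,e)$$ be the trace of the $2m\pi$-Poincaré matrix. Then $\tau_{m,p}$ has a (right-hand) derivative at $e=0$, and $$\tau_{m,p}'(0)=-p\,T'(h_{m,p})\int_0^{2m\pi}F_{23}(t)\,\dot\phi_{m,p}(t)\,dt,\qquad F_{23}(t)=\frac{\partial^2F}{\partial t\,\partial e}(\phi_{m,p}(t),t,0).$$ -/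

import Mathlib

open Set Filter Topology MeasureTheory
open scoped ContDiff

/-- `F(x,t,e)` is smooth on `ℝ³`, odd in `x`, even and `2π`-periodic in `t`, and for `e = 0` it
reduces to an autonomous force `f` with `x f(x) > 0` for `x ≠ 0`. -/
structure IsSymmetricForce (F : ℝ → ℝ → ℝ → ℝ) (f : ℝ → ℝ) : Prop where
  smooth : ContDiff ℝ ∞ (fun z : ℝ × ℝ × ℝ => F z.1 z.2.1 z.2.2)
  odd_x : ∀ x t e, F (-x) t e = -F x t e
  even_t : ∀ x t e, F x (-t) e = F x t e
  periodic_t : ∀ x t e, F x (t + 2 * Real.pi) e = F x t e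
  autonomous : ∀ x t, F x t 0 = f x
  sign : ∀ x, x ≠ 0 → 0 < x * f x

/-- `x : ℝ → ℝ` is a (twice differentiable, globally defined) solution of `ẍ + G(x,t) = 0`. -/
def SolvesNewton (G : ℝ → ℝ → ℝ) (x : ℝ → ℝ) : Prop :=
  Differentiable ℝ x ∧ ∀ t, HasDerivAt (deriv x) (-G (x t) t) t

/-- The potential `∫₀ˣ f(u) du`. -/
noncomputable def potential (f : ℝ → ℝ) (x : ℝ) : ℝ := ∫ u in (0 : ℝ)..x, f u

/-- The minimal period `T(h)` of the orbit `½ẋ² + ∫₀ˣ f = h` of `ẍ + f(x) = 0`: the infimum of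
the positive periods of the solutions lying on this energy level. For
`0 < h < sup (potential f)` the level is one nonconstant closed orbit and the infimum is
attained. -/
noncomputable def periodFunction (f : ℝ → ℝ) (h : ℝ) : ℝ :=
  sInf {T : ℝ | 0 < T ∧ ∃ x : ℝ → ℝ, SolvesNewton (fun y _ => f y) x ∧
    (∀ t, (deriv x t) ^ 2 / 2 + potential f (x t) = h) ∧ Function.Periodic x T}

/-- A continuous branch, `0 ≤ e < e₀`, of solutions `φ e` of `ẍ + F(x,t,e) = 0` with
`φ e 0 = 0`, initial velocity `V e`, and `φ e (mπ) = 0`, which starts at `V 0 = η`. In view of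
the symmetries of `F` such solutions are odd and `mπ`-antiperiodic. -/
structure IsOddBranch (F : ℝ → ℝ → ℝ → ℝ) (m : ℕ) (η e₀ : ℝ) (V : ℝ → ℝ) (φ : ℝ → ℝ → ℝ) :
    Prop where
  pos : 0 < e₀
  continuousOn : ContinuousOn V (Ico 0 e₀)
  start : V 0 = η
  solves : ∀ e ∈ Ico 0 e₀, SolvesNewton (fun x t => F x t e) (φ e)
  initial_position : ∀ e ∈ Ico 0 e₀, φ e 0 = 0
  initial_velocity : ∀ e ∈ Ico 0 e₀, deriv (φ e) 0 = V e
  endpoint : ∀ e ∈ Ico 0 e₀, φ e (m * Real.pi) = 0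

/-- `ψ₁, ψ₂` are the fundamental solutions of Hill's equation `ÿ + q(t) y = 0`. -/
structure IsFundamentalPair (q ψ₁ ψ₂ : ℝ → ℝ) : Prop where
  solves₁ : SolvesNewton (fun y t => q t * y) ψ₁
  solves₂ : SolvesNewton (fun y t => q t * y) ψ₂
  position₁ : ψ₁ 0 = 1
  velocity₁ : deriv ψ₁ 0 = 0
  position₂ : ψ₂ 0 = 0
  velocity₂ : deriv ψ₂ 0 = 1

/-- The potential `q(t) = ∂F/∂x (x(t),t,e)` of the linearization of `ẍ + F(x,t,e) = 0` along
`x`. -/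
noncomputable def linearization (F : ℝ → ℝ → ℝ → ℝ) (e : ℝ) (x : ℝ → ℝ) (t : ℝ) : ℝ :=
  deriv (fun y => F y t e) (x t)

/-- The mixed partial derivative `∂²F/∂t∂e (x,t,e)`. -/
noncomputable def mixedPartial (F : ℝ → ℝ → ℝ → ℝ) (x t e : ℝ) : ℝ :=
  deriv (fun s => deriv (fun a => F x s a) e) t

/-- The trace of the `T`-Poincaré matrix of Hill's equation with fundamental solutions
`ψ₁, ψ₂`. -/
noncomputable def poincareTrace (ψ₁ ψ₂ : ℝ → ℝ) (T : ℝ) : ℝ :=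
  Matrix.trace !![ψ₁ T, ψ₂ T; deriv ψ₁ T, deriv ψ₂ T]

/-!
Let `S = 2mπ`. The symmetries of `F` force every solution of the branch to satisfy
`φ(S - t) = -φ(t)`, so the potential of its Hill equation is symmetric about `S/2`, and by constancy
of Wronskians the trace equals `2 ψ̇₂(S)`. On the other hand `φ̇` solves the Hill equation up to the
forcing term `-∂F/∂t`, and Lagrange's identity between `φ̇` and `ψ₂` gives the exact formula
`V(e) (τ(e) - 2) = 2 ∫₀ˢ ∂F/∂t(φ,t,e) ψ₂ dt`. As `∂F/∂t` vanishes for `e = 0`, it is `e` times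
a continuous function, so dividing by `e` and letting `e → 0` needs only that `φ` and `ψ₂` depend
continuously on `e`: the result is `τ'(0) = (2 / η) ∫₀ˢ F₂₃ ψ₂ dt`.

For `e = 0` one has `φ̇ = η ψ₁` and `ψ₂(S - t) = ψ₂(S) ψ₁(t) - ψ₂(t)`, while
`F₂₃(S - t) = F₂₃(t)`; hence `2 ∫₀ˢ F₂₃ ψ₂ dt = (ψ₂(S) / η) ∫₀ˢ F₂₃ φ̇ dt`. Finally `ψ₂` is the
derivative of the autonomous solutions with respect to their initial velocity `√(2k)`, and
differentiating the condition that the solution of energy `k` vanishes at time `p T(k)` yields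
`ψ₂(S) = -p η² T'(h)`.
-/

section Analysis

open scoped NNReal

variable {E E' : Type*} [NormedAddCommGroup E] [NormedSpace ℝ E] [NormedAddCommGroup E']
  [NormedSpace ℝ E']

theorem exists_continuous_hadamard_factor [CompleteSpace E'] {f : E → E'} (hf : ContDiff ℝ 1 f) :
    ∃ A : E × E → E →L[ℝ] E', Continuous A ∧ (∀ x, A (x, x) = fderiv ℝ f x) ∧
      ∀ x y, f y - f x = A (x, y) (y - x) := by
  have : Continuous (fderiv ℝ f) := hf.continuous_fderiv one_ne_zero
  refine ⟨fun z => ∫ s in (0 : ℝ)..1, fderiv ℝ f (z.1 + s • (z.2 - z.1)), ?_, fun x => by simp,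
    fun x y => ?_⟩
  · exact intervalIntegral.continuous_parametric_intervalIntegral_of_continuous'
      (by fun_prop) 0 1
  have hpath : ∀ s ∈ uIcc (0 : ℝ) 1, HasDerivAt (fun s : ℝ => f (x + s • (y - x)))
      (fderiv ℝ f (x + s • (y - x)) (y - x)) s := fun s _ =>
    ((hf.differentiable one_ne_zero) _).hasFDerivAt.comp_hasDerivAt s
      (by simpa using ((hasDerivAt_id s).smul_const (y - x)).const_add x)
  have hftc := intervalIntegral.integral_eq_sub_of_hasDerivAt hpath
    (Continuous.intervalIntegrable (by fun_prop) 0 1)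
  rw [ContinuousLinearMap.intervalIntegral_apply
    (Continuous.intervalIntegrable (by fun_prop) 0 1), hftc]
  simp

theorem hasDerivWithinAt_of_mul_sub_eq {τ V I : ℝ → ℝ} {s : Set ℝ} {a η I₀ : ℝ} (hη : η ≠ 0)
    (hV : Tendsto V (𝓝[s] a) (𝓝 η)) (hI : Tendsto I (𝓝[s] a) (𝓝 I₀))
    (h : ∀ᶠ e in 𝓝[s] a, V e * (τ e - τ a) = (e - a) * I e) :
    HasDerivWithinAt τ (I₀ / η) s a := by
  rw [hasDerivWithinAt_iff_tendsto_slope]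
  have hle : 𝓝[s \ {a}] a ≤ 𝓝[s] a := nhdsWithin_mono a sdiff_subset
  refine ((hI.div hV hη).mono_left hle).congr' ?_
  filter_upwards [hle (hV.eventually_ne hη), hle h, self_mem_nhdsWithin] with e hVe he hmem
  have hne : e - a ≠ 0 := sub_ne_zero.2 hmem.2
  rw [slope_def_field, Pi.div_apply, div_eq_div_iff hVe hne]
  linear_combination -he

/-- A form of the Heine–Cantor theorem: the approximating maps may leave the compact image of the
limit, so uniform continuity of `H` on that image would not suffice. -/
theorem tendstoUniformlyOn_continuous_comp {ι X α β : Type*} [TopologicalSpace X] [UniformSpace α]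
    [UniformSpace β] {l : Filter ι} {s : Set X} {γ : ι → X → α} {γ₀ : X → α} {H : α → β}
    (hH : Continuous H) (hs : IsCompact s) (hγ₀ : ContinuousOn γ₀ s)
    (hγ : TendstoUniformlyOn γ γ₀ l s) :
    TendstoUniformlyOn (fun i x => H (γ i x)) (fun x => H (γ₀ x)) l s := by
  intro u hu
  filter_upwards [hγ _ ((hs.image_of_continuousOn hγ₀).uniformContinuousAt_of_continuousAt H
    (fun a _ => hH.continuousAt) hu)] with i hi x hx using hi x hx (mem_image_of_mem γ₀ hx)

theorem tendstoUniformlyOn_prodMk {ι X α β : Type*} [UniformSpace α] [UniformSpace β]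
    {l : Filter ι} {s : Set X} {γ : ι → X → α} {γ₀ : X → α} {δ : ι → X → β} {δ₀ : X → β}
    (hγ : TendstoUniformlyOn γ γ₀ l s) (hδ : TendstoUniformlyOn δ δ₀ l s) :
    TendstoUniformlyOn (fun i x => (γ i x, δ i x)) (fun x => (γ₀ x, δ₀ x)) l s :=
  fun u hu => tendsto_diag.eventually ((hγ.prodMk hδ) u hu)

theorem tendstoUniformlyOn_refl {ι X β : Type*} [UniformSpace β] (g : X → β) (l : Filter ι)
    (s : Set X) : TendstoUniformlyOn (fun _ => g) g l s :=
  fun _ hu => .of_forall fun _ _ _ => refl_mem_uniformity hu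

theorem norm_sub_le_of_perturbed_ode {v v₀ : ℝ → E → E} {γ γ₀ : ℝ → E} {a b δ : ℝ} {K : ℝ≥0}
    (hδ : 0 ≤ δ) (hγ : ∀ t, HasDerivAt γ (v t (γ t)) t) (hγ₀ : ∀ t, HasDerivAt γ₀ (v₀ t (γ₀ t)) t)
    (hLip : ∀ t ∈ Icc a b, LipschitzOnWith K (v₀ t) (Metric.closedBall (γ₀ t) δ))
    (hv : ∀ t ∈ Icc a b, ∀ z ∈ Metric.closedBall (γ₀ t) δ,
      ‖v t z - v₀ t z‖ < δ * Real.exp ((K + 1) * (a - b)))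
    (ha : ‖γ a - γ₀ a‖ ≤ δ * Real.exp ((K + 1) * (a - b))) :
    ∀ t ∈ Icc a b, ‖γ t - γ₀ t‖ ≤ δ := by
  -- The rate `K + 1` instead of Gronwall's `K` leaves room for the perturbation `v - v₀`.
  set B : ℝ → ℝ := fun t => δ * Real.exp ((K + 1) * (t - b)) with hB
  have hB_deriv : ∀ t, HasDerivAt B ((K + 1) * B t) t := fun t => by
    have := ((((hasDerivAt_id t).sub_const b).const_mul ((K : ℝ) + 1)).exp).const_mul δ
    exact this.congr_deriv (by simp only [hB, id]; ring)
  have hB_mono : Monotone B := fun s t hst => by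
    simp only [hB]
    gcongr
  have hB_le : ∀ t ≤ b, B t ≤ δ := fun t ht => (hB_mono ht).trans_eq (by simp [hB])
  have hbound : ∀ s ∈ Ico a b, ‖γ s - γ₀ s‖ = B s →
      ‖v s (γ s) - v₀ s (γ₀ s)‖ < (K + 1) * B s := fun s hs hsB => by
    have hs' : s ∈ Icc a b := Ico_subset_Icc_self hs
    have hmem : γ s ∈ Metric.closedBall (γ₀ s) δ := by
      rw [mem_closedBall_iff_norm, hsB]
      exact hB_le s hs'.2
    have hstate : ‖v₀ s (γ s) - v₀ s (γ₀ s)‖ ≤ K * B s := by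
      rw [← hsB]
      exact (hLip s hs').norm_sub_le hmem (Metric.mem_closedBall_self hδ)
    calc ‖v s (γ s) - v₀ s (γ₀ s)‖
        ≤ ‖v s (γ s) - v₀ s (γ s)‖ + ‖v₀ s (γ s) - v₀ s (γ₀ s)‖ :=
          norm_sub_le_norm_sub_add_norm_sub _ _ _
      _ < B a + K * B s := add_lt_add_of_lt_of_le (hv s hs' _ hmem) hstate
      _ ≤ (K + 1) * B s := by linarith [hB_mono hs.1]
  exact fun t ht => (image_norm_le_of_norm_deriv_right_lt_deriv_boundary
    (fun s _ => ((hγ s).sub (hγ₀ s)).continuousAt.continuousWithinAt)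
    (fun s _ => ((hγ s).sub (hγ₀ s)).hasDerivWithinAt) ha hB_deriv hbound ht).trans (hB_le t ht.2)

theorem tendstoUniformlyOn_ode_solution {ι : Type*} {l : Filter ι} {v : ι → ℝ → E → E}
    {v₀ : ℝ → E → E} {γ : ι → ℝ → E} {γ₀ : ℝ → E} {a b r : ℝ} {K : ℝ≥0} (hr : 0 < r)
    (hγ : ∀ᶠ i in l, ∀ t, HasDerivAt (γ i) (v i t (γ i t)) t)
    (hγ₀ : ∀ t, HasDerivAt γ₀ (v₀ t (γ₀ t)) t)
    (hLip : ∀ t ∈ Icc a b, LipschitzOnWith K (v₀ t) (Metric.closedBall (γ₀ t) r))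
    (hv : TendstoUniformlyOn (fun i z => v i z.1 z.2) (fun z => v₀ z.1 z.2) l
      {z : ℝ × E | z.1 ∈ Icc a b ∧ z.2 ∈ Metric.closedBall (γ₀ z.1) r})
    (ha : Tendsto (fun i => γ i a) l (𝓝 (γ₀ a))) :
    TendstoUniformlyOn γ γ₀ l (Icc a b) := by
  rw [Metric.tendstoUniformlyOn_iff]
  intro η hη
  obtain ⟨δ, hδ, hδη, hδr⟩ : ∃ δ > 0, δ < η ∧ δ ≤ r :=
    ⟨min (η / 2) r, by positivity, (min_le_left _ _).trans_lt (half_lt_self hη), min_le_right _ _⟩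
  have hε : 0 < δ * Real.exp ((K + 1) * (a - b)) := by positivity
  filter_upwards [hγ, Metric.tendstoUniformlyOn_iff.1 hv _ hε,
    ha.eventually (Metric.closedBall_mem_nhds _ hε)] with i hi hvi hai t ht
  rw [dist_comm, dist_eq_norm]
  refine (norm_sub_le_of_perturbed_ode hδ.le hi hγ₀
    (fun s hs => (hLip s hs).mono (Metric.closedBall_subset_closedBall hδr)) (fun s hs z hz => ?_)
    (mem_closedBall_iff_norm.1 hai) t ht).trans_lt hδη
  rw [← dist_eq_norm, dist_comm]
  exact hvi (s, z) ⟨hs, Metric.closedBall_subset_closedBall hδr hz⟩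

end Analysis

/-- The first-order vector field on the phase plane whose solutions are the pairs `(x, ẋ)` with
`ẍ + G(x,t) = 0`. -/
def newtonField (G : ℝ → ℝ → ℝ) (t : ℝ) (z : ℝ × ℝ) : ℝ × ℝ := (z.2, -G z.1 t)

/-- `G(x,t)` is Lipschitz in `x`, with a constant that is uniform on each square
`[-R,R] × [-R,R]`: the regularity under which `ẍ + G(x,t) = 0` has unique solutions that depend
continuously on the data. -/
def LipschitzOnSquares (G : ℝ → ℝ → ℝ) : Prop :=
  ∀ R : ℝ, ∃ K : NNReal, ∀ t ∈ Icc (-R) R, LipschitzOnWith K (fun x => G x t) (Icc (-R) R)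

namespace LipschitzOnSquares

theorem of_contDiff {G : ℝ → ℝ → ℝ} (hG : ContDiff ℝ 1 fun z : ℝ × ℝ => G z.1 z.2) :
    LipschitzOnSquares G := fun R => by
  obtain ⟨K, hK⟩ := hG.contDiffOn.exists_lipschitzOnWith one_ne_zero
    ((convex_Icc (-R) R).prod (convex_Icc (-R) R)) (isCompact_Icc.prod isCompact_Icc)
  refine ⟨K, fun t ht => ?_⟩
  simpa [Function.comp_def] using
    hK.comp (LipschitzWith.prodMk_right t).lipschitzOnWith fun x hx => ⟨hx, ht⟩

theorem autonomous {f : ℝ → ℝ} (hf : ContDiff ℝ 1 f) : LipschitzOnSquares fun x _ => f x :=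
  .of_contDiff (hf.comp contDiff_fst)

theorem hill {q : ℝ → ℝ} (hq : Continuous q) : LipschitzOnSquares fun x t => q t * x := fun R => by
  obtain ⟨C, hC⟩ := isCompact_Icc.exists_bound_of_continuousOn (hq.continuousOn (s := Icc (-R) R))
  refine ⟨C.toNNReal, fun t ht => LipschitzOnWith.of_dist_le_mul fun x _ y _ => ?_⟩
  rw [Real.dist_eq, Real.dist_eq, ← mul_sub, abs_mul]
  gcongr
  exact (hC t ht).trans (Real.le_coe_toNNReal C)

theorem exists_lipschitzOnWith_newtonField {G : ℝ → ℝ → ℝ} (hG : LipschitzOnSquares G) (R : ℝ) :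
    ∃ K, ∀ t ∈ Icc (-R) R, LipschitzOnWith K (newtonField G t) (Metric.closedBall 0 R) := by
  obtain ⟨K, hK⟩ := hG R
  refine ⟨max 1 K, fun t ht => LipschitzWith.prod_snd.lipschitzOnWith.prodMk ?_⟩
  have hmaps : MapsTo Prod.fst (Metric.closedBall (0 : ℝ × ℝ) R) (Icc (-R) R) := fun z hz =>
    abs_le.1 ((norm_fst_le z).trans (mem_closedBall_zero_iff.1 hz))
  have hG_fst := (hK t ht).comp LipschitzWith.prod_fst.lipschitzOnWith hmaps
  rw [mul_one] at hG_fst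
  exact hG_fst.neg

end LipschitzOnSquares

namespace SolvesNewton

variable {G : ℝ → ℝ → ℝ} {x y : ℝ → ℝ}

theorem hasDerivAt (hx : SolvesNewton G x) (t : ℝ) : HasDerivAt x (deriv x t) t :=
  (hx.1 t).hasDerivAt

theorem continuous (hx : SolvesNewton G x) : Continuous x := hx.1.continuous

theorem continuous_deriv (hx : SolvesNewton G x) : Continuous (deriv x) :=
  continuous_iff_continuousAt.2 fun t => (hx.2 t).continuousAt

theorem of_hasDerivAt {v : ℝ → ℝ} (hx : ∀ t, HasDerivAt x (v t) t)
    (hv : ∀ t, HasDerivAt v (-G (x t) t) t) : SolvesNewton G x :=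
  ⟨fun t => (hx t).differentiableAt, by rwa [deriv_eq hx]⟩

theorem neg (hx : SolvesNewton G x) : SolvesNewton (fun y t => -G (-y) t) (fun t => -x t) :=
  of_hasDerivAt (fun t => (hx.hasDerivAt t).neg) fun t => (hx.2 t).neg.congr_deriv (by simp)

theorem comp_add_const (hx : SolvesNewton G x) (s : ℝ) :
    SolvesNewton (fun y t => G y (t + s)) (fun t => x (t + s)) :=
  of_hasDerivAt (fun t => (hx.hasDerivAt _).comp_add_const t s)
    fun t => (hx.2 _).comp_add_const t s

theorem comp_const_sub (hx : SolvesNewton G x) (s : ℝ) :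
    SolvesNewton (fun y t => G y (s - t)) (fun t => x (s - t)) :=
  of_hasDerivAt (fun t => (hx.hasDerivAt _).comp_const_sub s t)
    fun t => ((hx.2 _).comp_const_sub s t).neg.congr_deriv (by simp)

theorem hasDerivAt_phase (hx : SolvesNewton G x) (t : ℝ) :
    HasDerivAt (fun s => (x s, deriv x s)) (newtonField G t (x t, deriv x t)) t :=
  (hx.hasDerivAt t).prodMk (hx.2 t)

theorem eq_of_eq_at (hx : SolvesNewton G x) (hG : LipschitzOnSquares G)
    (hy : SolvesNewton G y) {t₀ : ℝ} (h0 : x t₀ = y t₀) (h0' : deriv x t₀ = deriv y t₀) :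
    x = y := by
  ext t
  set T : ℝ := max |t| |t₀| + 1
  have hphase : ∀ {z}, SolvesNewton G z → ContinuousOn (fun s => (z s, deriv z s)) (Icc (-T) T) :=
    fun hz => (hz.continuous.prodMk hz.continuous_deriv).continuousOn
  obtain ⟨C, hC⟩ := isCompact_Icc.exists_bound_of_continuousOn (hphase hx)
  obtain ⟨D, hD⟩ := isCompact_Icc.exists_bound_of_continuousOn (hphase hy)
  set R := max T (max C D)
  obtain ⟨K, hK⟩ := hG.exists_lipschitzOnWith_newtonField R
  have ht : t ∈ Ioo (-T) T := abs_lt.1 ((le_max_left _ _).trans_lt (lt_add_one _))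
  have ht₀ : t₀ ∈ Ioo (-T) T := abs_lt.1 ((le_max_right _ _).trans_lt (lt_add_one _))
  have hIcc : Ioo (-T) T ⊆ Icc (-T) T := Ioo_subset_Icc_self
  have hIccR : Icc (-T) T ⊆ Icc (-R) R :=
    Icc_subset_Icc (neg_le_neg (le_max_left _ _)) (le_max_left _ _)
  have hCR : C ≤ R := (le_max_left C D).trans (le_max_right _ _)
  have hDR : D ≤ R := (le_max_right C D).trans (le_max_right _ _)
  have heq := ODE_solution_unique_of_mem_Ioo (fun s hs => hK s (hIccR (hIcc hs))) ht₀
    (fun s hs => ⟨hx.hasDerivAt_phase s,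
      mem_closedBall_zero_iff.2 ((hC s (hIcc hs)).trans hCR)⟩)
    (fun s hs => ⟨hy.hasDerivAt_phase s,
      mem_closedBall_zero_iff.2 ((hD s (hIcc hs)).trans hDR)⟩)
    (Prod.ext h0 h0')
  exact congrArg Prod.fst (heq ht)

theorem tendstoUniformlyOn {ι : Type*} {l : Filter ι} {Gi : ι → ℝ → ℝ → ℝ} {xi : ι → ℝ → ℝ}
    {S : ℝ} (hx : SolvesNewton G x) (hG : LipschitzOnSquares G)
    (hxi : ∀ᶠ i in l, SolvesNewton (Gi i) (xi i))
    (hGi : ∀ R, TendstoUniformlyOn (fun i z => Gi i z.1 z.2) (fun z => G z.1 z.2) l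
      (Icc (-R) R ×ˢ Icc 0 S))
    (h0 : Tendsto (fun i => xi i 0) l (𝓝 (x 0)))
    (h0' : Tendsto (fun i => deriv (xi i) 0) l (𝓝 (deriv x 0))) :
    TendstoUniformlyOn xi x l (Icc 0 S) := by
  obtain ⟨C, hC⟩ := isCompact_Icc.exists_bound_of_continuousOn
    ((hx.continuous.prodMk hx.continuous_deriv).continuousOn (s := Icc 0 S))
  set R := max S (C + 1)
  obtain ⟨K, hK⟩ := hG.exists_lipschitzOnWith_newtonField R
  have htube : ∀ t ∈ Icc 0 S,
      Metric.closedBall (x t, deriv x t) 1 ⊆ Metric.closedBall (0 : ℝ × ℝ) R := fun t ht =>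
    Metric.closedBall_subset_closedBall' (by
      rw [dist_zero_right]
      linarith [hC t ht, le_max_right S (C + 1)])
  have hIcc : Icc 0 S ⊆ Icc (-R) R := fun t ht =>
    ⟨by linarith [ht.1, ht.2, le_max_left S (C + 1)], ht.2.trans (le_max_left _ _)⟩
  have hphase := tendstoUniformlyOn_ode_solution (γ := fun i t => (xi i t, deriv (xi i) t))
    (γ₀ := fun t => (x t, deriv x t)) (v := fun i => newtonField (Gi i)) (a := 0) (b := S)
    one_pos (hxi.mono fun i hi => hi.hasDerivAt_phase) hx.hasDerivAt_phase
    (fun t ht => (hK t (hIcc ht)).mono (htube t ht)) ?_ (h0.prodMk_nhds h0')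
  · exact uniformContinuous_fst.comp_tendstoUniformlyOn hphase
  rw [Metric.tendstoUniformlyOn_iff]
  intro ε hε
  filter_upwards [Metric.tendstoUniformlyOn_iff.1 (hGi R) ε hε] with i hi z hz
  have hz' := (norm_fst_le _).trans (mem_closedBall_zero_iff.1 (htube z.1 hz.1 hz.2))
  simpa [newtonField, Prod.dist_eq, hε] using hi (z.2.1, z.1) ⟨abs_le.1 hz', hz.1⟩

end SolvesNewton

/-- The Wronskian `x ẏ - ẋ y` of two scalar functions, constant along two solutions of one Hill
equation. -/
noncomputable def wronskian (x y : ℝ → ℝ) (t : ℝ) : ℝ := x t * deriv y t - deriv x t * y t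

namespace SolvesNewton

variable {q g χ w : ℝ → ℝ}

theorem hasDerivAt_wronskian (hχ : SolvesNewton (fun y t => q t * y) χ)
    (hw : SolvesNewton (fun y t => q t * y - g t) w) (t : ℝ) :
    HasDerivAt (wronskian χ w) (g t * χ t) t :=
  (((hχ.hasDerivAt t).mul (hw.2 t)).sub ((hχ.2 t).mul (hw.hasDerivAt t))).congr_deriv (by ring)

theorem integral_mul_eq_wronskian_sub (hχ : SolvesNewton (fun y t => q t * y) χ)
    (hw : SolvesNewton (fun y t => q t * y - g t) w) (hg : Continuous g) (a b : ℝ) :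
    ∫ t in a..b, g t * χ t = wronskian χ w b - wronskian χ w a :=
  intervalIntegral.integral_eq_sub_of_hasDerivAt (fun t _ => hχ.hasDerivAt_wronskian hw t)
    ((hg.mul hχ.continuous).intervalIntegrable a b)

theorem wronskian_eq (hχ : SolvesNewton (fun y t => q t * y) χ)
    (hw : SolvesNewton (fun y t => q t * y) w) (s t : ℝ) : wronskian χ w s = wronskian χ w t := by
  have hderiv : ∀ t, HasDerivAt (wronskian χ w) 0 t := fun t => by
    simpa using hχ.hasDerivAt_wronskian (g := 0) (by simpa using hw) t
  exact is_const_of_deriv_eq_zero (fun t => (hderiv t).differentiableAt)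
    (fun t => (hderiv t).deriv) s t

theorem tendstoUniformlyOn_hill {ι : Type*} {l : Filter ι} {qi χi : ι → ℝ → ℝ} {S : ℝ}
    (hq : Continuous q) (hχ : SolvesNewton (fun y t => q t * y) χ)
    (hχi : ∀ᶠ i in l, SolvesNewton (fun y t => qi i t * y) (χi i))
    (hqi : TendstoUniformlyOn qi q l (Icc 0 S))
    (h0 : Tendsto (fun i => χi i 0) l (𝓝 (χ 0)))
    (h0' : Tendsto (fun i => deriv (χi i) 0) l (𝓝 (deriv χ 0))) :
    TendstoUniformlyOn χi χ l (Icc 0 S) := by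
  refine hχ.tendstoUniformlyOn (.hill hq) hχi (fun R => ?_) h0 h0'
  rw [Metric.tendstoUniformlyOn_iff] at hqi ⊢
  intro ε hε
  filter_upwards [hqi (ε / (|R| + 1)) (by positivity)] with i hi z hz
  have hz₁ : |z.1| < |R| + 1 :=
    ((abs_le.2 hz.1).trans (le_abs_self R)).trans_lt (lt_add_one _)
  calc dist (q z.2 * z.1) (qi i z.2 * z.1)
      = dist (q z.2) (qi i z.2) * |z.1| := by simp only [Real.dist_eq, ← sub_mul, abs_mul]
    _ < ε / (|R| + 1) * (|R| + 1) :=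
      mul_lt_mul'' (hi z.2 hz.2) hz₁ dist_nonneg (abs_nonneg _)
    _ = ε := div_mul_cancel₀ ε (by positivity)

end SolvesNewton

namespace IsFundamentalPair

variable {q ψ₁ ψ₂ : ℝ → ℝ} {T : ℝ}

theorem wronskian_eq_one (hψ : IsFundamentalPair q ψ₁ ψ₂) (t : ℝ) : wronskian ψ₁ ψ₂ t = 1 := by
  rw [hψ.solves₁.wronskian_eq hψ.solves₂ t 0]
  simp [wronskian, hψ.position₁, hψ.velocity₁, hψ.velocity₂]

theorem eq_combination (hψ : IsFundamentalPair q ψ₁ ψ₂) {y : ℝ → ℝ}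
    (hy : SolvesNewton (fun y t => q t * y) y) (t : ℝ) :
    y t = y 0 * ψ₁ t + deriv y 0 * ψ₂ t := by
  have h₁ : wronskian ψ₁ y t = deriv y 0 := by
    rw [hψ.solves₁.wronskian_eq hy t 0]
    simp [wronskian, hψ.position₁, hψ.velocity₁]
  have h₂ : wronskian y ψ₂ t = y 0 := by
    rw [hy.wronskian_eq hψ.solves₂ t 0]
    simp [wronskian, hψ.position₂, hψ.velocity₂]
  have hW := hψ.wronskian_eq_one t
  rw [← h₁, ← h₂]
  simp only [wronskian] at hW ⊢
  linear_combination -y t * hW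

section Symmetric

variable (hψ : IsFundamentalPair q ψ₁ ψ₂) (hq : ∀ t, q (T - t) = q t)
include hψ hq

theorem solves_reflected : SolvesNewton (fun y t => q t * y) fun t => ψ₂ (T - t) := by
  simpa only [hq] using hψ.solves₂.comp_const_sub T

theorem position₁_eq_velocity₂ : ψ₁ T = deriv ψ₂ T := by
  have hW := hψ.solves₁.wronskian_eq (hψ.solves_reflected hq) T 0
  simpa [wronskian, deriv_comp_const_sub, hψ.position₁, hψ.velocity₁, hψ.position₂,
    hψ.velocity₂] using hW

theorem poincareTrace_eq : poincareTrace ψ₁ ψ₂ T = 2 * deriv ψ₂ T := by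
  rw [poincareTrace, Matrix.trace_fin_two_of, hψ.position₁_eq_velocity₂ hq, two_mul]

theorem two_mul_integral_eq {M : ℝ → ℝ} (hM : ∀ t, M (T - t) = M t) (hM_cont : Continuous M)
    (hT : deriv ψ₂ T = 1) :
    2 * ∫ t in (0 : ℝ)..T, M t * ψ₂ t = ψ₂ T * ∫ t in (0 : ℝ)..T, M t * ψ₁ t := by
  have hreflect : ∀ t, ψ₂ (T - t) = ψ₂ T * ψ₁ t - ψ₂ t := fun t => by
    have hcomb := hψ.eq_combination (hψ.solves_reflected hq) t
    rw [deriv_comp_const_sub] at hcomb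
    simpa [hT, sub_eq_add_neg] using hcomb
  have hint : ∀ {χ : ℝ → ℝ}, Continuous χ → IntervalIntegrable (fun t => M t * χ t) volume 0 T :=
    fun hχ => (hM_cont.mul hχ).intervalIntegrable 0 T
  have hsub : ∫ t in (0 : ℝ)..T, M t * ψ₂ t =
      ψ₂ T * (∫ t in (0 : ℝ)..T, M t * ψ₁ t) - ∫ t in (0 : ℝ)..T, M t * ψ₂ t := by
    calc ∫ t in (0 : ℝ)..T, M t * ψ₂ t = ∫ t in (0 : ℝ)..T, M (T - t) * ψ₂ (T - t) := by
          simp [intervalIntegral.integral_comp_sub_left (fun t => M t * ψ₂ t) T]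
      _ = ∫ t in (0 : ℝ)..T, (ψ₂ T * (M t * ψ₁ t) - M t * ψ₂ t) :=
          intervalIntegral.integral_congr fun t _ => by
            simp only [hM, hreflect]
            ring
      _ = _ := by
          rw [intervalIntegral.integral_sub ((hint hψ.solves₁.continuous).const_mul _)
            (hint hψ.solves₂.continuous), intervalIntegral.integral_const_mul]
  linarith

end Symmetric

end IsFundamentalPair

theorem periodic_deriv {x : ℝ → ℝ} {T : ℝ} (hx : Function.Periodic x T) :
    Function.Periodic (deriv x) T := fun t => by
  rw [← deriv_comp_add_const, funext hx]

namespace SolvesNewton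

variable {f x χ : ℝ → ℝ}

theorem exists_periodic_through_zero (hf_odd : Function.Odd f) (hf_zero : ∀ x, f x = 0 → x = 0)
    {k T : ℝ} (hx : SolvesNewton (fun y _ => f y) x)
    (henergy : ∀ t, (deriv x t) ^ 2 / 2 + potential f (x t) = k) (hT : 0 < T)
    (hper : Function.Periodic x T) :
    ∃ y, SolvesNewton (fun y _ => f y) y ∧ y 0 = 0 ∧ deriv y 0 = Real.sqrt (2 * k) ∧
      Function.Periodic y T := by
  obtain ⟨c, -, hc⟩ := exists_hasDerivAt_eq_zero hT hx.continuous_deriv.continuousOn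
    (periodic_deriv hper).eq.symm (fun t _ => hx.2 t)
  have hxc : x c = 0 := hf_zero _ (neg_eq_zero.1 hc)
  have hspeed : |deriv x c| = Real.sqrt (2 * k) := by
    rw [← Real.sqrt_sq_eq_abs, ← henergy c, hxc, potential, intervalIntegral.integral_same]
    ring_nf
  have hshift : Function.Periodic (fun t => x (t + c)) T := hper.add_const c
  rcases le_total 0 (deriv x c) with hpos | hneg
  · refine ⟨fun t => x (t + c), hx.comp_add_const c, by simpa, ?_, hshift⟩
    rw [deriv_comp_add_const, zero_add, ← hspeed, abs_of_nonneg hpos]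
  · refine ⟨fun t => -x (t + c), ?_, by simpa, ?_, fun t => congrArg Neg.neg (hshift t)⟩
    · simpa only [hf_odd _, neg_neg] using (hx.comp_add_const c).neg
    · rw [deriv.fun_neg, deriv_comp_add_const, zero_add, ← hspeed, abs_of_nonpos hneg]

theorem exists_periodic_periodFunction (hf : ContDiff ℝ 1 f) (hf_odd : Function.Odd f)
    (hf_zero : ∀ x, f x = 0 → x = 0) {k : ℝ} (hk : 0 < periodFunction f k) :
    ∃ y, SolvesNewton (fun y _ => f y) y ∧ y 0 = 0 ∧ deriv y 0 = Real.sqrt (2 * k) ∧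
      Function.Periodic y (periodFunction f k) := by
  rw [periodFunction] at hk ⊢
  set P := {T : ℝ | 0 < T ∧ ∃ x : ℝ → ℝ, SolvesNewton (fun y _ => f y) x ∧
    (∀ t, (deriv x t) ^ 2 / 2 + potential f (x t) = k) ∧ Function.Periodic x T}
  have hsol : ∀ T ∈ P, ∃ y, SolvesNewton (fun y _ => f y) y ∧ y 0 = 0 ∧
      deriv y 0 = Real.sqrt (2 * k) ∧ Function.Periodic y T := fun T ⟨hT, x, hx, henergy, hper⟩ =>
    hx.exists_periodic_through_zero hf_odd hf_zero henergy hT hper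
  have hP : P.Nonempty := nonempty_iff_ne_empty.2 fun h => by simp [h] at hk
  obtain ⟨T₀, hT₀⟩ := hP
  obtain ⟨y, hy, hy0, hy0', -⟩ := hsol T₀ hT₀
  have hclosed : IsClosed {T | Function.Periodic y T} := by
    simp only [Function.Periodic, ofPred_forall]
    exact isClosed_iInter fun t =>
      isClosed_eq (hy.continuous.comp (continuous_const.add continuous_id)) continuous_const
  have hsub : P ⊆ {T | Function.Periodic y T} := fun T hT => by
    obtain ⟨z, hz, hz0, hz0', hper⟩ := hsol T hT
    rwa [mem_ofPred_eq, hy.eq_of_eq_at (.autonomous hf) hz (hy0.trans hz0.symm)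
      (hy0'.trans hz0'.symm)]
  exact ⟨y, hy, hy0, hy0', closure_minimal hsub hclosed
    (csInf_mem_closure ⟨T₀, hT₀⟩ ⟨0, fun T hT => hT.1.le⟩)⟩

theorem sub_div_const {G : ℝ → ℝ → ℝ} {y a : ℝ → ℝ} (hx : SolvesNewton G x) (hy : SolvesNewton G y)
    (ha : ∀ t, G (y t) t - G (x t) t = a t * (y t - x t)) (c : ℝ) :
    SolvesNewton (fun z t => a t * z) fun t => (y t - x t) / c :=
  .of_hasDerivAt (fun t => ((hy.hasDerivAt t).sub (hx.hasDerivAt t)).div_const c)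
    fun t => (((hy.2 t).sub (hx.2 t)).div_const c).congr_deriv (by
      rw [← mul_div_assoc, ← ha]
      ring)

theorem tendstoUniformlyOn_difference_quotient {ι : Type*} {l : Filter ι} {y : ι → ℝ → ℝ}
    (hf : ContDiff ℝ 1 f) (hx : SolvesNewton (fun y _ => f y) x)
    (hχ : SolvesNewton (fun y t => deriv f (x t) * y) χ) (hχ0 : χ 0 = 0) (hχ0' : deriv χ 0 = 1)
    (hy : ∀ᶠ i in l, SolvesNewton (fun y _ => f y) (y i)) (h0 : ∀ᶠ i in l, y i 0 = x 0)
    (h0' : Tendsto (fun i => deriv (y i) 0) l (𝓝 (deriv x 0)))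
    (hne : ∀ᶠ i in l, deriv (y i) 0 - deriv x 0 ≠ 0) (S : ℝ) :
    TendstoUniformlyOn (fun i t => (y i t - x t) / (deriv (y i) 0 - deriv x 0)) χ l
      (Icc 0 S) := by
  obtain ⟨A, hA_cont, hA_diag, hA⟩ := exists_continuous_hadamard_factor hf
  have hyx : TendstoUniformlyOn y x l (Icc 0 S) :=
    hx.tendstoUniformlyOn (.autonomous hf) hy (fun R => tendstoUniformlyOn_refl _ _ _)
      (tendsto_const_nhds.congr' (h0.mono fun i hi => hi.symm)) h0'
  have hcoeff : TendstoUniformlyOn (fun i t => A (x t, y i t) 1) (fun t => deriv f (x t)) l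
      (Icc 0 S) := by
    simp only [← fderiv_apply_one_eq_deriv, ← hA_diag]
    exact tendstoUniformlyOn_continuous_comp (H := fun z => A z 1) (by fun_prop) isCompact_Icc
      (hx.continuous.prodMk hx.continuous).continuousOn
      (tendstoUniformlyOn_prodMk (tendstoUniformlyOn_refl _ _ _) hyx)
  refine hχ.tendstoUniformlyOn_hill
    ((hf.continuous_deriv_one).comp hx.continuous) (hy.mono fun i hi => ?_) hcoeff ?_ ?_
  · exact hx.sub_div_const hi (fun t => by
      rw [hA, mul_comm, ← smul_eq_mul, ← map_smul, smul_eq_mul, mul_one]) _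
  · rw [hχ0]
    exact tendsto_const_nhds.congr' (h0.mono fun i hi => by simp [hi])
  · rw [hχ0']
    refine tendsto_const_nhds.congr' ?_
    filter_upwards [hy, hne] with i hi hnei
    rw [deriv_div_const, deriv_fun_sub (hi.1 0) (hx.1 0), div_self hnei]

/-- The first variation of `y_k(s(k)) = 0` at `k = h`; here `χ` is the derivative of the solutions
with respect to their initial velocity. -/
theorem deriv_mul_add_mul_eq_zero_of_zeros {y : ℝ → ℝ → ℝ} {s : ℝ → ℝ} {h s' v' : ℝ}
    (hf : ContDiff ℝ 1 f) (hy : ∀ᶠ k in 𝓝 h, SolvesNewton (fun y _ => f y) (y k))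
    (h0 : ∀ᶠ k in 𝓝 h, y k 0 = y h 0) (hv : HasDerivAt (fun k => deriv (y k) 0) v' h)
    (hv' : v' ≠ 0) (hχ : SolvesNewton (fun z t => deriv f (y h t) * z) χ) (hχ0 : χ 0 = 0)
    (hχ0' : deriv χ 0 = 1) (hs : HasDerivAt s s' h) (hs_pos : 0 < s h)
    (hzero : ∀ᶠ k in 𝓝 h, y k (s k) = 0) :
    deriv (y h) (s h) * s' + v' * χ (s h) = 0 := by
  have hle : 𝓝[≠] h ≤ 𝓝 h := nhdsWithin_le_nhds
  have hx := hy.self_of_nhds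
  have hne : ∀ᶠ k in 𝓝[≠] h, deriv (y k) 0 - deriv (y h) 0 ≠ 0 :=
    (hv.eventually_ne hv').mono fun k hk => sub_ne_zero.2 hk
  have hunif := hx.tendstoUniformlyOn_difference_quotient hf hχ hχ0 hχ0' (hle hy) (hle h0)
    (hv.continuousAt.mono_left hle) hne (s h + 1)
  have hs_mem : ∀ᶠ k in 𝓝[≠] h, s k ∈ Icc 0 (s h + 1) :=
    hle (hs.continuousAt.eventually_mem (Icc_mem_nhds hs_pos (lt_add_one _)))
  have hquot := hunif.tendsto_comp hχ.continuous.continuousWithinAt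
    (tendsto_nhdsWithin_iff.2 ⟨hs.continuousAt.mono_left hle, hs_mem⟩)
  have hcurve : HasDerivAt (fun k => y h (s k)) (deriv (y h) (s h) * s') h :=
    (hx.hasDerivAt _).comp h hs
  refine tendsto_nhds_unique (hcurve.tendsto_slope.add (hv.tendsto_slope.mul hquot))
    (tendsto_const_nhds.congr' ?_)
  filter_upwards [hne, hle hzero] with k hk hk0
  rw [slope_def_field, slope_def_field, hk0, hzero.self_of_nhds]
  field_simp
  ring

theorem fundamental_eq_neg_mul_deriv_periodFunction (hf : ContDiff ℝ 1 f)
    (hf_odd : Function.Odd f) (hf_zero : ∀ x, f x = 0 → x = 0) {h : ℝ} (h_pos : 0 < h)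
    (hT_pos : 0 < periodFunction f h) (hT : DifferentiableAt ℝ (periodFunction f) h)
    (hx : SolvesNewton (fun y _ => f y) x) (hx0 : x 0 = 0) (hx0' : deriv x 0 = Real.sqrt (2 * h))
    (hχ : SolvesNewton (fun y t => deriv f (x t) * y) χ) (hχ0 : χ 0 = 0) (hχ0' : deriv χ 0 = 1)
    {p : ℕ} (hp : 0 < p) :
    χ (p * periodFunction f h) = -(p * (2 * h) * deriv (periodFunction f) h) := by
  have hsol : ∀ k, 0 < periodFunction f k → ∃ y, SolvesNewton (fun y _ => f y) y ∧ y 0 = 0 ∧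
      deriv y 0 = Real.sqrt (2 * k) ∧ Function.Periodic y (periodFunction f k) := fun k hk =>
    exists_periodic_periodFunction hf hf_odd hf_zero hk
  choose! y hy hy0 hy0' hy_per using hsol
  obtain rfl : x = y h := hx.eq_of_eq_at (.autonomous hf) (hy h hT_pos)
    (hx0.trans (hy0 h hT_pos).symm) (hx0'.trans (hy0' h hT_pos).symm)
  have hpos : ∀ᶠ k in 𝓝 h, 0 < periodFunction f k :=
    hT.continuousAt.eventually_const_lt hT_pos
  have hsqrt : HasDerivAt (fun k => Real.sqrt (2 * k)) (1 / Real.sqrt (2 * h)) h :=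
    (((hasDerivAt_id' h).const_mul 2).sqrt (by positivity)).congr_deriv (by field_simp)
  have hvariation := deriv_mul_add_mul_eq_zero_of_zeros hf (hpos.mono hy)
    (hpos.mono fun k hk => (hy0 k hk).trans hx0.symm)
    (hsqrt.congr_of_eventuallyEq (hpos.mono hy0')) (by positivity) hχ hχ0 hχ0'
    (hT.hasDerivAt.const_mul (p : ℝ)) (by positivity)
    (hpos.mono fun k hk => (((hy_per k hk).nat_mul p).eq).trans (hy0 k hk))
  rw [((periodic_deriv (hy_per h hT_pos)).nat_mul p).eq, hx0'] at hvariation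
  have hsq : Real.sqrt (2 * h) * Real.sqrt (2 * h) = 2 * h := Real.mul_self_sqrt (by positivity)
  field_simp at hvariation
  linear_combination hvariation - p * deriv (periodFunction f) h * hsq

end SolvesNewton

section PartialDerivatives

/-- The partial derivative `∂F/∂t (x,t,e)`, the forcing term of the linear equation satisfied by the
velocity of a solution. -/
noncomputable def timePartial (F : ℝ → ℝ → ℝ → ℝ) (x t e : ℝ) : ℝ := deriv (fun s => F x s e) t

theorem fderiv_fderiv_apply_comm {E E' : Type*} [NormedAddCommGroup E] [NormedSpace ℝ E]
    [NormedAddCommGroup E'] [NormedSpace ℝ E'] {Φ : E → E'} (hΦ : ContDiff ℝ 2 Φ) (z v w : E) :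
    fderiv ℝ (fun y => fderiv ℝ Φ y v) z w = fderiv ℝ (fun y => fderiv ℝ Φ y w) z v := by
  have hdiff : DifferentiableAt ℝ (fderiv ℝ Φ) z :=
    ((hΦ.fderiv_right (m := 1) le_rfl).differentiable one_ne_zero).differentiableAt
  have hsymm : IsSymmSndFDerivAt ℝ Φ z :=
    hΦ.contDiffAt.isSymmSndFDerivAt (by simp)
  rw [fderiv_clm_apply hdiff (differentiableAt_const v),
    fderiv_clm_apply hdiff (differentiableAt_const w)]
  simpa using hsymm.eq w v

variable {Φ : ℝ × ℝ × ℝ → ℝ}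

theorem deriv_fst_eq_fderiv (hΦ : Differentiable ℝ Φ) (x t e : ℝ) :
    deriv (fun y => Φ (y, t, e)) x = fderiv ℝ Φ (x, t, e) (1, 0, 0) :=
  ((hΦ _).hasFDerivAt.comp_hasDerivAt x ((hasDerivAt_id x).prodMk
    (hasDerivAt_const x (t, e)))).deriv

theorem deriv_snd_eq_fderiv (hΦ : Differentiable ℝ Φ) (x t e : ℝ) :
    deriv (fun s => Φ (x, s, e)) t = fderiv ℝ Φ (x, t, e) (0, 1, 0) :=
  ((hΦ _).hasFDerivAt.comp_hasDerivAt t ((hasDerivAt_const t x).prodMk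
    ((hasDerivAt_id t).prodMk (hasDerivAt_const t e)))).deriv

theorem deriv_thd_eq_fderiv (hΦ : Differentiable ℝ Φ) (x t e : ℝ) :
    deriv (fun a => Φ (x, t, a)) e = fderiv ℝ Φ (x, t, e) (0, 0, 1) :=
  ((hΦ _).hasFDerivAt.comp_hasDerivAt e ((hasDerivAt_const e x).prodMk
    ((hasDerivAt_const e t).prodMk (hasDerivAt_id e)))).deriv

variable {F : ℝ → ℝ → ℝ → ℝ}

theorem continuous_deriv_fst (hF : ContDiff ℝ 1 fun z : ℝ × ℝ × ℝ => F z.1 z.2.1 z.2.2) :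
    Continuous fun z : ℝ × ℝ × ℝ => deriv (fun y => F y z.2.1 z.2.2) z.1 := by
  simp only [fun z : ℝ × ℝ × ℝ =>
    deriv_fst_eq_fderiv (hF.differentiable one_ne_zero) z.1 z.2.1 z.2.2]
  exact (hF.continuous_fderiv one_ne_zero).clm_apply continuous_const

theorem contDiff_timePartial (hF : ContDiff ℝ 2 fun z : ℝ × ℝ × ℝ => F z.1 z.2.1 z.2.2) :
    ContDiff ℝ 1 fun z : ℝ × ℝ × ℝ => timePartial F z.1 z.2.1 z.2.2 := by
  simp only [timePartial, fun z : ℝ × ℝ × ℝ =>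
    deriv_snd_eq_fderiv (hF.differentiable two_ne_zero) z.1 z.2.1 z.2.2]
  exact (hF.fderiv_right (m := 1) le_rfl).clm_apply contDiff_const

theorem hasDerivAt_force_along (hF : Differentiable ℝ fun z : ℝ × ℝ × ℝ => F z.1 z.2.1 z.2.2)
    {x : ℝ → ℝ} {v t : ℝ} (hx : HasDerivAt x v t) (e : ℝ) :
    HasDerivAt (fun s => F (x s) s e) (linearization F e x t * v + timePartial F (x t) t e) t := by
  have hcurve : HasDerivAt (fun s => (x s, s, e)) (v, (1 : ℝ), (0 : ℝ)) t :=
    hx.prodMk ((hasDerivAt_id t).prodMk (hasDerivAt_const t e))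
  refine ((hF (x t, t, e)).hasFDerivAt.comp_hasDerivAt t hcurve).congr_deriv ?_
  have hsplit : ((v, 1, 0) : ℝ × ℝ × ℝ) = v • (1, 0, 0) + (0, 1, 0) := by simp
  rw [linearization, timePartial, deriv_fst_eq_fderiv hF, deriv_snd_eq_fderiv hF, hsplit, map_add,
    map_smul, smul_eq_mul, mul_comm v]

theorem mixedPartial_eq_deriv_timePartial
    (hF : ContDiff ℝ 2 fun z : ℝ × ℝ × ℝ => F z.1 z.2.1 z.2.2) (x t e : ℝ) :
    mixedPartial F x t e = deriv (fun a => timePartial F x t a) e := by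
  have hdiff := hF.differentiable two_ne_zero
  have hdiff' (v : ℝ × ℝ × ℝ) : Differentiable ℝ
      fun z => fderiv ℝ (fun z : ℝ × ℝ × ℝ => F z.1 z.2.1 z.2.2) z v :=
    ((hF.fderiv_right (m := 1) le_rfl).clm_apply contDiff_const).differentiable one_ne_zero
  simp only [mixedPartial, timePartial, fun x s e => deriv_thd_eq_fderiv hdiff x s e,
    fun x s e => deriv_snd_eq_fderiv hdiff x s e]
  rw [deriv_snd_eq_fderiv (hdiff' _), deriv_thd_eq_fderiv (hdiff' _), fderiv_fderiv_apply_comm hF]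

theorem exists_timePartial_eq_mul (hF : ContDiff ℝ 2 fun z : ℝ × ℝ × ℝ => F z.1 z.2.1 z.2.2)
    (h0 : ∀ x t, timePartial F x t 0 = 0) :
    ∃ H : ℝ × ℝ × ℝ → ℝ, Continuous H ∧ (∀ x t, H (x, t, 0) = mixedPartial F x t 0) ∧
      ∀ x t e, timePartial F x t e = e * H (x, t, e) := by
  obtain ⟨A, hA_cont, hA_diag, hA⟩ := exists_continuous_hadamard_factor (contDiff_timePartial hF)
  refine ⟨fun z => A ((z.1, z.2.1, 0), z) (0, 0, 1), by fun_prop, fun x t => ?_, fun x t e => ?_⟩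
  · rw [mixedPartial_eq_deriv_timePartial hF,
      deriv_thd_eq_fderiv ((contDiff_timePartial hF).differentiable one_ne_zero), ← hA_diag]
  · have hvec : ((x, t, e) : ℝ × ℝ × ℝ) - (x, t, 0) = e • (0, 0, 1) := by simp
    have := hA (x, t, 0) (x, t, e)
    rwa [h0, sub_zero, hvec, map_smul, smul_eq_mul] at this

end PartialDerivatives

namespace IsSymmetricForce

variable {F : ℝ → ℝ → ℝ → ℝ} {f : ℝ → ℝ} {m : ℕ}

theorem contDiff_two (hF : IsSymmetricForce F f) :
    ContDiff ℝ 2 fun z : ℝ × ℝ × ℝ => F z.1 z.2.1 z.2.2 :=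
  contDiff_infty.1 hF.smooth 2

theorem contDiff_one (hF : IsSymmetricForce F f) :
    ContDiff ℝ 1 fun z : ℝ × ℝ × ℝ => F z.1 z.2.1 z.2.2 :=
  hF.contDiff_two.of_le one_le_two

theorem continuous_linearization (hF : IsSymmetricForce F f) (e : ℝ) {x : ℝ → ℝ}
    (hx : Continuous x) : Continuous (linearization F e x) :=
  (continuous_deriv_fst hF.contDiff_one).comp (hx.prodMk (continuous_id.prodMk continuous_const))

theorem lipschitzOnSquares (hF : IsSymmetricForce F f) (e : ℝ) :
    LipschitzOnSquares fun x t => F x t e :=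
  .of_contDiff (hF.contDiff_one.comp (contDiff_fst.prodMk (contDiff_snd.prodMk contDiff_const)))

theorem contDiff_force (hF : IsSymmetricForce F f) : ContDiff ℝ 1 f := by
  simpa only [Function.comp_def, id, hF.autonomous] using
    hF.contDiff_one.comp (contDiff_id.prodMk (contDiff_const (c := ((0 : ℝ), (0 : ℝ)))))

theorem odd_force (hF : IsSymmetricForce F f) : Function.Odd f := fun x => by
  simpa only [hF.autonomous] using hF.odd_x x 0 0

theorem eq_zero_of_force_eq_zero (hF : IsSymmetricForce F f) {x : ℝ} (hx : f x = 0) : x = 0 := by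
  by_contra hne
  simpa [hx] using hF.sign x hne

theorem solvesNewton_zero_iff (hF : IsSymmetricForce F f) {x : ℝ → ℝ} :
    SolvesNewton (fun y t => F y t 0) x ↔ SolvesNewton (fun y _ => f y) x := by
  simp only [hF.autonomous]

theorem linearization_zero (hF : IsSymmetricForce F f) (x : ℝ → ℝ) :
    linearization F 0 x = fun t => deriv f (x t) := by
  funext t
  simp only [linearization, hF.autonomous]

theorem timePartial_zero (hF : IsSymmetricForce F f) (x t : ℝ) : timePartial F x t 0 = 0 := by
  simp only [timePartial, hF.autonomous, deriv_const]

theorem map_zero (hF : IsSymmetricForce F f) (t e : ℝ) : F 0 t e = 0 :=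
  self_eq_neg.1 (by simpa using hF.odd_x 0 t e)

theorem reflect_time (hF : IsSymmetricForce F f) (m : ℕ) (x t e : ℝ) :
    F x (2 * m * Real.pi - t) e = F x t e := by
  have hper : Function.Periodic (fun s => F x s e) (2 * Real.pi) := fun s => hF.periodic_t x s e
  calc F x (2 * m * Real.pi - t) e = F x (m * (2 * Real.pi) - t) e := by ring_nf
    _ = F x (-t) e := hper.nat_mul_sub_eq m
    _ = F x t e := hF.even_t x t e

theorem timePartial_reflect (hF : IsSymmetricForce F f) (m : ℕ) (x t e : ℝ) :
    timePartial F (-x) (2 * m * Real.pi - t) e = timePartial F x t e := by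
  have hneg : (fun s => F (-x) s e) = fun s => -F x (2 * m * Real.pi - s) e := by
    funext s
    rw [hF.odd_x, hF.reflect_time]
  rw [timePartial, hneg, deriv.fun_neg, deriv_comp_const_sub (fun s => F x s e), timePartial]
  simp

theorem mixedPartial_reflect (hF : IsSymmetricForce F f) (m : ℕ) (x t e : ℝ) :
    mixedPartial F (-x) (2 * m * Real.pi - t) e = mixedPartial F x t e := by
  simp only [mixedPartial_eq_deriv_timePartial hF.contDiff_two, hF.timePartial_reflect]

variable {x : ℝ → ℝ} {e : ℝ}

theorem linearization_reflect (hF : IsSymmetricForce F f)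
    (hrefl : ∀ t, x (2 * m * Real.pi - t) = -x t) (t : ℝ) :
    linearization F e x (2 * m * Real.pi - t) = linearization F e x t := by
  have heven := deriv_comp_neg (fun y => F y t e) (x t)
  simp only [hF.odd_x, deriv.fun_neg, neg_inj] at heven
  simp only [linearization, hrefl, hF.reflect_time, heven]

theorem solution_reflect (hF : IsSymmetricForce F f) (hx : SolvesNewton (fun y t => F y t e) x)
    (hmid : x (m * Real.pi) = 0) (t : ℝ) : x (2 * m * Real.pi - t) = -x t := by
  have hy : SolvesNewton (fun y t => F y t e) fun t => -x (2 * m * Real.pi - t) := by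
    simpa only [hF.odd_x, neg_neg, hF.reflect_time] using
      (hx.comp_const_sub (2 * m * Real.pi)).neg
  have hmid_eq : 2 * m * Real.pi - m * Real.pi = m * Real.pi := by ring
  have heq := hy.eq_of_eq_at (hF.lipschitzOnSquares e) hx (t₀ := m * Real.pi)
    (by simp only [hmid_eq, hmid, neg_zero])
    (by rw [deriv.fun_neg, deriv_comp_const_sub, neg_neg, hmid_eq])
  rw [← congrFun heq t, neg_neg]

end IsSymmetricForce

namespace IsSymmetricForce

variable {F : ℝ → ℝ → ℝ → ℝ} {f : ℝ → ℝ} {m : ℕ} {e : ℝ} {x ψ₁ ψ₂ : ℝ → ℝ}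

theorem continuous_timePartial_along (hF : IsSymmetricForce F f) (e : ℝ) (hx : Continuous x) :
    Continuous fun t => timePartial F (x t) t e :=
  (contDiff_timePartial hF.contDiff_two).continuous.comp
    (hx.prodMk (continuous_id.prodMk continuous_const))

theorem solvesNewton_deriv (hF : IsSymmetricForce F f) (hx : SolvesNewton (fun y t => F y t e) x) :
    SolvesNewton (fun y t => linearization F e x t * y - -timePartial F (x t) t e) (deriv x) :=
  .of_hasDerivAt hx.2 fun t =>
    (hasDerivAt_force_along (hF.contDiff_one.differentiable one_ne_zero)
      (hx.hasDerivAt t) e).neg.congr_deriv (by ring)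

theorem velocity_mul_trace_sub_two (hF : IsSymmetricForce F f)
    (hx : SolvesNewton (fun y t => F y t e) x) (h0 : x 0 = 0) (hmid : x (m * Real.pi) = 0)
    (hψ : IsFundamentalPair (linearization F e x) ψ₁ ψ₂) :
    deriv x 0 * (poincareTrace ψ₁ ψ₂ (2 * m * Real.pi) - 2) =
      2 * ∫ t in (0 : ℝ)..(2 * m * Real.pi), timePartial F (x t) t e * ψ₂ t := by
  set S : ℝ := 2 * m * Real.pi
  have hrefl : ∀ t, x (S - t) = -x t := hF.solution_reflect hx hmid
  have hxS : x S = 0 := by simpa [h0] using hrefl 0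
  have hvS : deriv x S = deriv x 0 := by
    have hderiv : deriv (fun t => x (S - t)) 0 = deriv (fun t => -x t) 0 := by
      rw [funext hrefl]
    rw [deriv_comp_const_sub, deriv.fun_neg, neg_inj, sub_zero] at hderiv
    exact hderiv
  have hlagrange := hψ.solves₂.integral_mul_eq_wronskian_sub (hF.solvesNewton_deriv hx)
    (hF.continuous_timePartial_along e hx.continuous).neg 0 S
  have hacc : ∀ {t}, x t = 0 → deriv (deriv x) t = 0 := fun {t} ht => by
    simp only [(hx.2 t).deriv, ht, hF.map_zero, neg_zero]
  simp only [wronskian, hacc h0, hacc hxS, hvS, hψ.velocity₂, neg_mul,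
    intervalIntegral.integral_neg] at hlagrange
  have htrace : poincareTrace ψ₁ ψ₂ S = 2 * deriv ψ₂ S :=
    hψ.poincareTrace_eq (hF.linearization_reflect hrefl)
  rw [htrace]
  linear_combination 2 * hlagrange

theorem deriv_eq_mul_fundamental (hF : IsSymmetricForce F f)
    (hx : SolvesNewton (fun y t => F y t 0) x) (h0 : x 0 = 0)
    (hψ : IsFundamentalPair (linearization F 0 x) ψ₁ ψ₂) (t : ℝ) :
    deriv x t = deriv x 0 * ψ₁ t := by
  have hv : SolvesNewton (fun y t => linearization F 0 x t * y) (deriv x) := by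
    simpa only [hF.timePartial_zero, neg_zero, sub_zero] using hF.solvesNewton_deriv hx
  have hacc : deriv (deriv x) 0 = 0 := by simp only [(hx.2 0).deriv, h0, hF.map_zero, neg_zero]
  rw [hψ.eq_combination hv t, hacc, zero_mul, add_zero]

end IsSymmetricForce

namespace IsOddBranch

variable {F : ℝ → ℝ → ℝ → ℝ} {f : ℝ → ℝ} {m : ℕ} {η e₀ : ℝ} {V : ℝ → ℝ} {φ ψ₁ ψ₂ : ℝ → ℝ → ℝ}

theorem eventually_mem (hφ : IsOddBranch F m η e₀ V φ) : ∀ᶠ e in 𝓝[≥] 0, e ∈ Ico 0 e₀ :=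
  Ico_mem_nhdsGE hφ.pos

theorem zero_mem (hφ : IsOddBranch F m η e₀ V φ) : (0 : ℝ) ∈ Ico 0 e₀ := left_mem_Ico.2 hφ.pos

theorem tendsto_velocity (hφ : IsOddBranch F m η e₀ V φ) : Tendsto V (𝓝[≥] 0) (𝓝 η) := by
  simpa only [ContinuousWithinAt, hφ.start, nhdsWithin_Ico_eq_nhdsGE hφ.pos] using
    hφ.continuousOn 0 hφ.zero_mem

theorem tendstoUniformlyOn (hφ : IsOddBranch F m η e₀ V φ) (hF : IsSymmetricForce F f) (S : ℝ) :
    TendstoUniformlyOn φ (φ 0) (𝓝[≥] 0) (Icc 0 S) := by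
  have h0 := hφ.zero_mem
  refine (hφ.solves 0 h0).tendstoUniformlyOn (hF.lipschitzOnSquares 0)
    (hφ.eventually_mem.mono hφ.solves) (fun R => ?_) ?_ ?_
  · exact tendstoUniformlyOn_continuous_comp (s := Icc (-R) R ×ˢ Icc 0 S)
      (γ := fun e z => (z, e)) (γ₀ := fun z : ℝ × ℝ => (z, (0 : ℝ)))
      (H := fun w : (ℝ × ℝ) × ℝ => F w.1.1 w.1.2 w.2)
      (hF.contDiff_one.continuous.comp (by fun_prop : Continuous fun w : (ℝ × ℝ) × ℝ =>
        (w.1.1, w.1.2, w.2)))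
      (isCompact_Icc.prod isCompact_Icc) (by fun_prop)
      (tendstoUniformlyOn_prodMk (tendstoUniformlyOn_refl id _ _)
        ((tendsto_id'.2 nhdsWithin_le_nhds).tendstoUniformlyOn_const _))
  · rw [hφ.initial_position 0 h0]
    exact tendsto_const_nhds.congr'
      (hφ.eventually_mem.mono fun e he => (hφ.initial_position e he).symm)
  · rw [hφ.initial_velocity 0 h0, hφ.start]
    exact hφ.tendsto_velocity.congr'
      (hφ.eventually_mem.mono fun e he => (hφ.initial_velocity e he).symm)

theorem tendstoUniformlyOn_graph (hφ : IsOddBranch F m η e₀ V φ) (hF : IsSymmetricForce F f)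
    (S : ℝ) : TendstoUniformlyOn (fun e t => (φ e t, t, e)) (fun t => (φ 0 t, t, 0)) (𝓝[≥] 0)
      (Icc 0 S) :=
  tendstoUniformlyOn_prodMk (hφ.tendstoUniformlyOn hF S)
    (tendstoUniformlyOn_prodMk (tendstoUniformlyOn_refl id _ _)
      ((tendsto_id'.2 nhdsWithin_le_nhds).tendstoUniformlyOn_const _))

theorem continuous_graph (hφ : IsOddBranch F m η e₀ V φ) {e : ℝ} (he : e ∈ Ico 0 e₀) :
    Continuous fun t => (φ e t, t, e) :=
  (hφ.solves e he).continuous.prodMk (continuous_id.prodMk continuous_const)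

theorem tendstoUniformlyOn_fundamental (hφ : IsOddBranch F m η e₀ V φ)
    (hF : IsSymmetricForce F f)
    (hψ : ∀ e ∈ Ico 0 e₀, IsFundamentalPair (linearization F e (φ e)) (ψ₁ e) (ψ₂ e)) (S : ℝ) :
    TendstoUniformlyOn ψ₂ (ψ₂ 0) (𝓝[≥] 0) (Icc 0 S) := by
  have h0 := hφ.zero_mem
  refine (hψ 0 h0).solves₂.tendstoUniformlyOn_hill
    (hF.continuous_linearization 0 (hφ.solves 0 h0).continuous)
    (hφ.eventually_mem.mono fun e he => (hψ e he).solves₂)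
    (tendstoUniformlyOn_continuous_comp (continuous_deriv_fst hF.contDiff_one) isCompact_Icc
      (hφ.continuous_graph h0).continuousOn (hφ.tendstoUniformlyOn_graph hF S)) ?_ ?_
  · rw [(hψ 0 h0).position₂]
    exact tendsto_const_nhds.congr'
      (hφ.eventually_mem.mono fun e he => (hψ e he).position₂.symm)
  · rw [(hψ 0 h0).velocity₂]
    exact tendsto_const_nhds.congr'
      (hφ.eventually_mem.mono fun e he => (hψ e he).velocity₂.symm)

theorem tendsto_integral_mul_fundamental (hφ : IsOddBranch F m η e₀ V φ)
    (hF : IsSymmetricForce F f)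
    (hψ : ∀ e ∈ Ico 0 e₀, IsFundamentalPair (linearization F e (φ e)) (ψ₁ e) (ψ₂ e)) {S : ℝ}
    (hS : 0 ≤ S) {H : ℝ × ℝ × ℝ → ℝ} (hH : Continuous H) :
    Tendsto (fun e => ∫ t in (0 : ℝ)..S, H (φ e t, t, e) * ψ₂ e t) (𝓝[≥] 0)
      (𝓝 (∫ t in (0 : ℝ)..S, H (φ 0 t, t, 0) * ψ₂ 0 t)) := by
  have h0 := hφ.zero_mem
  have hunif := tendstoUniformlyOn_prodMk (hφ.tendstoUniformlyOn_graph hF S)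
    (hφ.tendstoUniformlyOn_fundamental hF hψ S)
  have hlim := tendstoUniformlyOn_continuous_comp
    (H := fun z : (ℝ × ℝ × ℝ) × ℝ => H z.1 * z.2) (by fun_prop) isCompact_Icc
    ((hφ.continuous_graph h0).prodMk (hψ 0 h0).solves₂.continuous).continuousOn hunif
  rw [← uIcc_of_le hS] at hlim
  exact hlim.tendsto_intervalIntegral_of_continuousOn (hφ.eventually_mem.mono fun e he =>
    ((hH.comp (hφ.continuous_graph he)).mul (hψ e he).solves₂.continuous).continuousOn)

theorem two_mul_integral_eq (hφ : IsOddBranch F m η e₀ V φ) (hF : IsSymmetricForce F f)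
    (hη : η ≠ 0) {χ₁ χ₂ : ℝ → ℝ} (hχ : IsFundamentalPair (linearization F 0 (φ 0)) χ₁ χ₂)
    (hv : deriv χ₂ (2 * m * Real.pi) = 1) (hM : Continuous fun t => mixedPartial F (φ 0 t) t 0) :
    2 * ∫ t in (0 : ℝ)..(2 * m * Real.pi), mixedPartial F (φ 0 t) t 0 * χ₂ t =
      χ₂ (2 * m * Real.pi) / η *
        ∫ t in (0 : ℝ)..(2 * m * Real.pi), mixedPartial F (φ 0 t) t 0 * deriv (φ 0) t := by
  have h0 := hφ.zero_mem
  have hrefl := hF.solution_reflect (hφ.solves 0 h0) (hφ.endpoint 0 h0)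
  have hvel : ∀ t, deriv (φ 0) t = η * χ₁ t := fun t => by
    rw [hF.deriv_eq_mul_fundamental (hφ.solves 0 h0) (hφ.initial_position 0 h0) hχ,
      hφ.initial_velocity 0 h0, hφ.start]
  rw [hχ.two_mul_integral_eq (hF.linearization_reflect hrefl)
    (fun t => by rw [hrefl, hF.mixedPartial_reflect]) hM hv]
  simp only [hvel, mul_left_comm (mixedPartial F _ _ 0) η, intervalIntegral.integral_const_mul]
  field_simp

theorem hasDerivWithinAt_poincareTrace (hφ : IsOddBranch F m η e₀ V φ)
    (hF : IsSymmetricForce F f) (hη : η ≠ 0)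
    (hψ : ∀ e ∈ Ico 0 e₀, IsFundamentalPair (linearization F e (φ e)) (ψ₁ e) (ψ₂ e)) :
    HasDerivWithinAt (fun e => poincareTrace (ψ₁ e) (ψ₂ e) (2 * m * Real.pi))
      (ψ₂ 0 (2 * m * Real.pi) / η ^ 2 *
        ∫ t in (0 : ℝ)..(2 * m * Real.pi), mixedPartial F (φ 0 t) t 0 * deriv (φ 0) t)
      (Ici 0) 0 := by
  have h0 := hφ.zero_mem
  obtain ⟨H, hH_cont, hH_zero, hH⟩ := exists_timePartial_eq_mul hF.contDiff_two hF.timePartial_zero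
  have htrace : ∀ e ∈ Ico 0 e₀, V e * (poincareTrace (ψ₁ e) (ψ₂ e) (2 * m * Real.pi) - 2) =
      e * (2 * ∫ t in (0 : ℝ)..(2 * m * Real.pi), H (φ e t, t, e) * ψ₂ e t) := fun e he => by
    rw [← hφ.initial_velocity e he, hF.velocity_mul_trace_sub_two (hφ.solves e he)
      (hφ.initial_position e he) (hφ.endpoint e he) (hψ e he)]
    simp only [hH, mul_assoc, intervalIntegral.integral_const_mul]
    ring
  have htrace_zero : poincareTrace (ψ₁ 0) (ψ₂ 0) (2 * m * Real.pi) = 2 := by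
    simpa [hφ.start, hη, sub_eq_zero] using htrace 0 h0
  have hv : deriv (ψ₂ 0) (2 * m * Real.pi) = 1 := by
    have hrefl := hF.solution_reflect (hφ.solves 0 h0) (hφ.endpoint 0 h0)
    linarith [(hψ 0 h0).poincareTrace_eq (hF.linearization_reflect hrefl)]
  have hM : Continuous fun t => mixedPartial F (φ 0 t) t 0 := by
    simpa only [hH_zero, Function.comp_def] using hH_cont.comp (hφ.continuous_graph h0)
  have hlim := (hφ.tendsto_integral_mul_fundamental hF hψ (S := 2 * m * Real.pi) (by positivity)
    hH_cont).const_mul 2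
  simp only [hH_zero, hφ.two_mul_integral_eq hF hη (hψ 0 h0) hv hM] at hlim
  refine (hasDerivWithinAt_of_mul_sub_eq hη hφ.tendsto_velocity hlim
    (hφ.eventually_mem.mono fun e he => ?_)).congr_deriv (by field_simp)
  rw [htrace_zero, sub_zero, htrace e he]

end IsOddBranch

theorem theorem3p2_general (F : ℝ → ℝ → ℝ → ℝ) (f : ℝ → ℝ) (hF : IsSymmetricForce F f)
    (m p : ℕ) (hm : 0 < m) (hp : 0 < p) (h : ℝ) (h_pos : 0 < h)
    (h_period : periodFunction f h = 2 * m * Real.pi / p)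
    (h_diff : DifferentiableAt ℝ (periodFunction f) h)
    (e₀ : ℝ) (V : ℝ → ℝ) (φ : ℝ → ℝ → ℝ) (hφ : IsOddBranch F m (Real.sqrt (2 * h)) e₀ V φ)
    (ψ₁ ψ₂ : ℝ → ℝ → ℝ)
    (hψ : ∀ e ∈ Set.Ico 0 e₀, IsFundamentalPair (linearization F e (φ e)) (ψ₁ e) (ψ₂ e)) :
    HasDerivWithinAt (fun e => poincareTrace (ψ₁ e) (ψ₂ e) (2 * m * Real.pi))
      (-(p : ℝ) * deriv (periodFunction f) h *
        ∫ t in (0 : ℝ)..(2 * m * Real.pi), mixedPartial F (φ 0 t) t 0 * deriv (φ 0) t)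
      (Set.Ici 0) 0 := by
  have h0 := hφ.zero_mem
  have hend : 2 * m * Real.pi = p * periodFunction f h := by
    rw [h_period]
    field_simp
  have hχ : SolvesNewton (fun y t => deriv f (φ 0 t) * y) (ψ₂ 0) := by
    simpa only [hF.linearization_zero] using (hψ 0 h0).solves₂
  have hfundamental : ψ₂ 0 (2 * m * Real.pi) = -(p * (2 * h) * deriv (periodFunction f) h) := by
    rw [hend]
    exact (hF.solvesNewton_zero_iff.1 (hφ.solves 0 h0)).fundamental_eq_neg_mul_deriv_periodFunction
      hF.contDiff_force hF.odd_force (fun _ => hF.eq_zero_of_force_eq_zero) h_pos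
      (by rw [h_period]; positivity) h_diff (hφ.initial_position 0 h0)
      ((hφ.initial_velocity 0 h0).trans hφ.start) hχ (hψ 0 h0).position₂ (hψ 0 h0).velocity₂ hp
  refine (hφ.hasDerivWithinAt_poincareTrace hF (by positivity) hψ).congr_deriv ?_
  rw [hfundamental, Real.sq_sqrt (by positivity)]
  field_simp

theorem theorem3p2 (F : ℝ → ℝ → ℝ → ℝ) (f : ℝ → ℝ) (hF : IsSymmetricForce F f)
    (m p : ℕ) (hm : 0 < m) (hp : 0 < p)
    (h : ℝ) (h_pos : 0 < h) (h_lt : ∃ x, h < potential f x)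
    (h_period : periodFunction f h = 2 * m * Real.pi / p)
    (h_nondeg : deriv (periodFunction f) h ≠ 0)
    (e₀ : ℝ) (V : ℝ → ℝ) (φ : ℝ → ℝ → ℝ)
    (hφ : IsOddBranch F m (Real.sqrt (2 * h)) e₀ V φ)
    (ψ₁ ψ₂ : ℝ → ℝ → ℝ)
    (hψ : ∀ e ∈ Set.Ico 0 e₀, IsFundamentalPair (linearization F e (φ e)) (ψ₁ e) (ψ₂ e)) :
    HasDerivWithinAt (fun e => poincareTrace (ψ₁ e) (ψ₂ e) (2 * m * Real.pi))
      (-(p : ℝ) * deriv (periodFunction f) h *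
        ∫ t in (0 : ℝ)..(2 * m * Real.pi), mixedPartial F (φ 0 t) t 0 * deriv (φ 0) t)
      (Set.Ici 0) 0 := by
  exact theorem3p2_general F f hF m p hm hp h h_pos h_period
    (differentiableAt_of_deriv_ne_zero h_nondeg) e₀ V φ hφ ψ₁ ψ₂ hψ
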